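/- Let $z\in\mathbb{C}\setminus(-\infty,1]$, with the phases $-\pi<\arg(z\pm1)<\pi$, so that $(z^2-1)^{a}=(z-1)^{a}(z+1)^{a}$ with principal powers; $\ln$ is the principal logarithm and $\psi=\Gamma'/\Gamma$ is the digamma function. For $m\in\mathbb{N}=\{0,1,2,\dots\}$ and $\nu\in\mathbb{C}$ not a negative integer, the associated Legendre function of the first kind is given by Schläfli's integral $$P_\nu^m(z)=\frac{\Gamma(\nu+m+1)}{\Gamma(\nu+1)}\,\frac{1}{2^{\nu+1}\pi\mathrm{i}}\,(z^2-1)^{m/2}\oint_{C}\frac{(t^2-1)^\nu}{(t-z)^{\nu+m+1}}\,\mathrm{d}t .$$ Here $C$ is any counter-clockwise circle that encloses $1$ and $z$ and neither meets nor encloses any point of $(-\infty,-1]$ (such circles exist), and the phases of the integrand on $C$ are determined by $\arg(t\pm1)=0$, $|\arg(t-z)|<\pi$ at the point where $C$ crosses the real axis to the right of $1$ (and of $z$, if $z$ is real); that is, the integrand is $(t+1)^\nu\left(\frac{t-1}{t-z}\right)^{\nu}(t-z)^{-m-1}$ with principal powers. Write $P_\nu=P_\nu^0$. Then, for all integers $0\le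 m\le n$, the function $\nu\mapsto P_\nu^m(z)$ is complex differentiable at $\nu=n$ and $$\frac{\partial P_\nu^m(z)}{\partial\nu}\bigg|_{\nu=n}=-P_n^m(z)\ln\frac{z+1}{2}+[\psi(n+m+1)-\psi(n+1)]P_n^m(z)+\frac{1}{2^n n!}(z^2-1)^{m/2}\frac{\mathrm{d}^{n+m}}{\mathrm{d}z^{n+m}}\left[(z^2-1)^n\ln\frac{z+1}{2}\right]+\frac{1}{2^n n!}\frac{(n+m)!}{(n-m)!}(z^2-1)^{-m/2}\frac{\mathrm{d}^{n-m}}{\mathrm{d}z^{n-m}}\left[(z^2-1)^n\ln\frac{z+1}{2}\right].$$ In particular, for $m=0$ one has Jolliffe's formula $$\frac{\partial P_\nu(z)}{\partial\nu}\bigg|_{\nu=n}=-P_n(z)\ln\frac{z+1}{2}+\frac{1}{2^{n-1}n!}\frac{\mathrm{d}^{n}}{\mathrm{d}z^{n}}\left[(z^2-1)^n\ln\frac{z+1}{2}\right].$$ -/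

import Mathlib

open Complex Metric

/-- The branch of `(t ^ 2 - 1) ^ ν / (t - z) ^ (ν + m + 1)` that is used in Schläfli's integral.
It is written as `(t + 1) ^ ν * ((t - 1) / (t - z)) ^ ν / (t - z) ^ (m + 1)` with principal powers,
hence it is analytic in `t` off the ray `(-∞, -1]` and the segment joining `1` and `z`.
At a real `t > 1` that is not on this segment one has `arg (t ± 1) = 0`, `|arg (t - z)| < π`
and `arg ((t - 1) / (t - z)) = - arg (t - z)`: these are the customary phases. -/
noncomputable def schlafliIntegrand (ν : ℂ) (m : ℕ) (z t : ℂ) : ℂ :=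
  (t + 1) ^ ν * ((t - 1) / (t - z)) ^ ν / (t - z) ^ (m + 1)

/-- The circle with centre `c` and radius `R` is a contour for Schläfli's integral at `z`: it
encloses `1` and `z` (so also the cut joining them), and it neither meets nor encloses a point of
the cut `(-∞, -1]`. -/
def IsSchlafliCircle (z c : ℂ) (R : ℝ) : Prop :=
  1 ∈ ball c R ∧ z ∈ ball c R ∧ ∀ x : ℝ, x ≤ -1 → (x : ℂ) ∉ closedBall c R

/-- The power `(z ^ 2 - 1) ^ a`, with the phases `-π < arg (z ± 1) < π`, that is,
`(z - 1) ^ a * (z + 1) ^ a` with principal powers. -/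
noncomputable def sqSubOnePow (z a : ℂ) : ℂ :=
  (z - 1) ^ a * (z + 1) ^ a

/-- The associated Legendre function of the first kind `P_ν^m(z)` of degree `ν` and order `m`,
for `z` off the cut `(-∞, 1]`, as Schläfli's integral along the circle with centre `c` and
radius `R`, run counter-clockwise (where `ν` is not a negative integer). -/
noncomputable def assocLegendreP (c : ℂ) (R : ℝ) (ν : ℂ) (m : ℕ) (z : ℂ) : ℂ :=
  Gamma (ν + m + 1) / Gamma (ν + 1) * (1 / (2 ^ (ν + 1) * Real.pi * I)) *
    sqSubOnePow z (m / 2) * ∮ t in C(c, R), schlafliIntegrand ν m z t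

/-- A circle is a contour as soon as these inequalities hold. -/
theorem isSchlafliCircle_sqrt {z c : ℂ} (hc : 0 < c.re)
    (hz : z.re ^ 2 + z.im ^ 2 - 1 < 2 * (z.re * c.re + z.im * c.im)) :
    IsSchlafliCircle z c (Real.sqrt (1 + c.re ^ 2 + c.im ^ 2)) := by
  refine ⟨?_, ?_, fun x hx => ?_⟩
  · rw [mem_ball, Complex.dist_eq_re_im]
    apply Real.sqrt_lt_sqrt (by positivity)
    simp only [one_re, one_im]
    nlinarith
  · rw [mem_ball, Complex.dist_eq_re_im]
    apply Real.sqrt_lt_sqrt (by positivity)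
    nlinarith
  · rw [mem_closedBall, not_le, Complex.dist_eq_re_im]
    apply Real.sqrt_lt_sqrt (by positivity)
    simp only [ofReal_re, ofReal_im]
    nlinarith

/-- Every point off the cut `(-∞, 1]` has a circle as a contour. -/
theorem exists_isSchlafliCircle {z : ℂ} (hz : z - 1 ∈ slitPlane) :
    ∃ c R, IsSchlafliCircle z c R := by
  by_cases hy : z.im = 0
  · have hx : 1 < z.re := by
      rcases hz with h | h
      · simpa using h
      · simp [hy] at h
    refine ⟨z, _, isSchlafliCircle_sqrt (by linarith) ?_⟩
    nlinarith
  · refine ⟨⟨1, (z.re ^ 2 + z.im ^ 2 - 2 * z.re) / (2 * z.im)⟩, _,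
      isSchlafliCircle_sqrt (by simp) ?_⟩
    have h : z.im * ((z.re ^ 2 + z.im ^ 2 - 2 * z.re) / (2 * z.im)) =
        (z.re ^ 2 + z.im ^ 2 - 2 * z.re) / 2 := by
      field_simp
    simp only
    rw [h]
    linarith

/-! The integrand is `exp (ν * L t)` times a power of `t - z`, with `L t = log (t + 1) + log ((t -
1) / (t - z))`, so differentiating at `ν = n` inserts `L` into the integral of `(t ^ 2 - 1) ^ n / (t
- z) ^ (n + m + 1)`. Split `L` as `log ((t + 1) / 2)`, plus `log ((t - 1) / (t - z)) + log ((z + 1)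
/ 2)`, plus a constant. The first summand is analytic inside the contour, and Cauchy's formula gives
the derivative of order `n + m`. For the second, the inversion `s = z + (z ^ 2 - 1) / (t - z)`
satisfies `(s + 1) / (z + 1) = (t - 1) / (t - z)`; it yields the same function in `s`, now with a
derivative of order `n - m` (`circleIntegral_mul_log_div`). The constant gives a multiple of
`P_n^m`, and the prefactor gives the digamma terms. -/

/-! ### Circle integrals: Cauchy's formula, inversion, parameter derivative -/

theorem CircleIntegrable.const_mul {f : ℂ → ℂ} {c : ℂ} {R : ℝ} (hf : CircleIntegrable f c R)
    (a : ℂ) : CircleIntegrable (fun t => a * f t) c R :=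
  hf.const_smul

/-- Induction on `k` through integration by parts; `U` is open so that `deriv f` satisfies the same
hypothesis. -/
theorem circleIntegral_mul_inv_pow_eq_iteratedDeriv {U : Set ℂ} (hU : IsOpen U) {c z : ℂ} {R : ℝ}
    (hR : closedBall c R ⊆ U) (hz : z ∈ ball c R) (k : ℕ) {f : ℂ → ℂ}
    (hf : DifferentiableOn ℂ f U) :
    (∮ t in C(c, R), f t * ((t - z) ^ (k + 1))⁻¹) =
      2 * Real.pi * I / (k.factorial : ℂ) * iteratedDeriv k f z := by
  have hR0 : 0 < R := dist_nonneg.trans_lt hz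
  have hne : ∀ t ∈ sphere c R, t - z ≠ 0 := by
    rintro t ht h
    rw [sub_eq_zero] at h
    subst h
    exact (mem_sphere.1 ht).not_lt hz
  induction k generalizing f with
  | zero =>
    have := (hf.mono hR).circleIntegral_sub_inv_smul hz
    simpa [mul_comm] using this
  | succ k ih =>
    have h1 := ih (hf.deriv hU)
    rw [← iteratedDeriv_succ'] at h1
    have hcont : ∀ {g : ℂ → ℂ} (j : ℕ), DifferentiableOn ℂ g U →
        CircleIntegrable (fun t => g t * ((t - z) ^ j)⁻¹) c R := by
      intro g j hg
      refine ContinuousOn.circleIntegrable hR0.le ?_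
      refine (hg.continuousOn.mono (sphere_subset_closedBall.trans hR)).mul ?_
      exact ContinuousOn.inv₀ (by fun_prop) fun t ht => pow_ne_zero _ (hne t ht)
    have h2 : (∮ t in C(c, R), (deriv f t * ((t - z) ^ (k + 1))⁻¹ -
        (k + 1) * (f t * ((t - z) ^ (k + 1 + 1))⁻¹))) = 0 := by
      refine circleIntegral.integral_eq_zero_of_hasDerivWithinAt
        (f := fun t => f t * ((t - z) ^ (k + 1))⁻¹) hR0.le fun t ht => ?_
      have ht' := hne t ht
      have hd : HasDerivAt f (deriv f t) t :=
        (hf.differentiableAt (hU.mem_nhds (hR (sphere_subset_closedBall ht)))).hasDerivAt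
      have hp := (((hasDerivAt_id t).sub_const z).pow (k + 1)).inv (pow_ne_zero _ ht')
      refine (HasDerivAt.congr_deriv (hd.mul hp) ?_).hasDerivWithinAt
      simp only [id, Nat.add_sub_cancel, Pi.inv_apply, Pi.pow_apply]
      field_simp
      push_cast
      ring
    rw [circleIntegral.integral_sub (hcont _ (hf.deriv hU))
      ((hcont (k + 1 + 1) hf).const_mul ((k : ℂ) + 1)),
      circleIntegral.integral_const_mul, h1, sub_eq_zero] at h2
    have hk : (k : ℂ) + 1 ≠ 0 := Nat.cast_add_one_ne_zero k
    have hk' : (k.factorial : ℂ) ≠ 0 := Nat.cast_ne_zero.2 k.factorial_ne_zero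
    apply mul_left_cancel₀ hk
    rw [← h2, Nat.factorial_succ]
    push_cast
    field_simp

/-- With `s = z + a / (t - z)` one has `(t - z) ^ (k - 1) dt = -a ^ k (s - z) ^ (-k - 1) ds`, and
`s` runs clockwise around `z`: this is Cauchy's formula in `s`. The proof uses primitives in `t` and
never transports the contour. -/
theorem circleIntegral_comp_inv_mul_zpow_eq_iteratedDeriv {a c z : ℂ} {r R : ℝ}
    (hz : z ∈ ball c R) (hr : ∀ t ∈ sphere c R, z + a / (t - z) ∈ ball z r) (k : ℕ) {f : ℂ → ℂ}
    (hf : DifferentiableOn ℂ f (ball z r)) :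
    (∮ t in C(c, R), f (z + a / (t - z)) * (t - z) ^ ((k : ℤ) - 1)) =
      2 * Real.pi * I / (k.factorial : ℂ) * a ^ k * iteratedDeriv k f z := by
  have hR0 : 0 < R := dist_nonneg.trans_lt hz
  have hne : ∀ t ∈ sphere c R, t - z ≠ 0 := by
    rintro t ht h
    rw [sub_eq_zero] at h
    subst h
    exact (mem_sphere.1 ht).not_lt hz
  have hr0 : 0 < r := by
    have := hr (circleMap c R 0) (circleMap_mem_sphere c hR0.le 0)
    exact dist_nonneg.trans_lt this
  have hsd : ∀ t ∈ sphere c R,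
      HasDerivAt (fun t => z + a / (t - z)) (-a * (t - z) ^ (-2 : ℤ)) t := by
    intro t ht
    have ht' := hne t ht
    have := ((((hasDerivAt_id t).sub_const z).inv ht').const_mul a).const_add z
    simp only [div_eq_mul_inv]
    refine this.congr_deriv ?_
    simp [zpow_neg, div_eq_mul_inv]
  have hsc : ContinuousOn (fun t => z + a / (t - z)) (sphere c R) := fun t ht =>
    (hsd t ht).continuousAt.continuousWithinAt
  have hint : ∀ {g : ℂ → ℂ} (j : ℤ), DifferentiableOn ℂ g (ball z r) →
      CircleIntegrable (fun t => g (z + a / (t - z)) * (t - z) ^ j) c R := by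
    intro g j hg
    refine ContinuousOn.circleIntegrable hR0.le ?_
    refine (hg.continuousOn.comp hsc hr).mul ?_
    exact ContinuousOn.zpow₀ (by fun_prop) _ fun t ht => Or.inl (hne t ht)
  induction k generalizing f with
  | zero =>
    have hzr : ball z r ∈ nhds z := ball_mem_nhds z hr0
    have hds : DifferentiableOn ℂ (dslope f z) (ball z r) :=
      (Complex.differentiableOn_dslope hzr).2 hf
    obtain ⟨H, hH⟩ := hds.isExactOn_ball
    -- By the chain rule `-H (s t)` is a primitive, where `H` is a primitive of the slope; only the
    -- `f z` term survives.
    have h0 : (∮ t in C(c, R), a * (dslope f z (z + a / (t - z)) * (t - z) ^ (-2 : ℤ))) = 0 := by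
      refine circleIntegral.integral_eq_zero_of_hasDerivWithinAt
        (f := fun t => -H (z + a / (t - z))) hR0.le fun t ht => ?_
      refine (((hH _ (hr t ht)).comp t (hsd t ht)).neg.congr_deriv ?_).hasDerivWithinAt
      ring
    have h1 : (∮ t in C(c, R), f (z + a / (t - z)) * (t - z) ^ (((0 : ℕ) : ℤ) - 1)) =
        ∮ t in C(c, R), (f z * (t - z)⁻¹ +
          a * (dslope f z (z + a / (t - z)) * (t - z) ^ (-2 : ℤ))) := by
      refine circleIntegral.integral_congr hR0.le fun t ht => ?_
      have ht' := hne t ht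
      have := sub_smul_dslope f z (z + a / (t - z))
      simp only [add_sub_cancel_left, smul_eq_mul] at this
      have e : f (z + a / (t - z)) = f z + a / (t - z) * dslope f z (z + a / (t - z)) := by
        rw [this]; ring
      simp only [e]
      simp only [Nat.cast_zero, zero_sub, zpow_neg, zpow_one]
      rw [show (t - z) ^ (2 : ℤ) = (t - z) ^ 2 by norm_cast]
      field_simp
    have i1 : CircleIntegrable (fun t => f z * (t - z)⁻¹) c R := by
      refine ContinuousOn.circleIntegrable hR0.le ?_
      exact continuousOn_const.mul (ContinuousOn.inv₀ (by fun_prop) hne)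
    rw [h1, circleIntegral.integral_add i1
      ((hint (-2) hds).const_mul a), h0,
      circleIntegral.integral_const_mul, circleIntegral.integral_sub_inv_of_mem_ball hz]
    simp [mul_comm]
  | succ k ih =>
    have hf' := hf.deriv isOpen_ball
    have h1 := ih hf'
    rw [← iteratedDeriv_succ'] at h1
    have h2 : (∮ t in C(c, R), ((k + 1 : ℂ) *
        (f (z + a / (t - z)) * (t - z) ^ (((k + 1 : ℕ) : ℤ) - 1)) -
        a * (deriv f (z + a / (t - z)) * (t - z) ^ ((k : ℤ) - 1)))) = 0 := by
      refine circleIntegral.integral_eq_zero_of_hasDerivWithinAt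
        (f := fun t => f (z + a / (t - z)) * (t - z) ^ (k + 1)) hR0.le fun t ht => ?_
      have ht' := hne t ht
      have hd : HasDerivAt f (deriv f (z + a / (t - z))) (z + a / (t - z)) :=
        (hf.differentiableAt (isOpen_ball.mem_nhds (hr t ht))).hasDerivAt
      have hp := ((hasDerivAt_id t).sub_const z).pow (k + 1)
      refine (HasDerivAt.congr_deriv ((hd.comp t (hsd t ht)).mul hp) ?_).hasDerivWithinAt
      simp only [id, Nat.add_sub_cancel, Pi.pow_apply, Function.comp_apply]
      have e1 : (t - z) ^ (((k + 1 : ℕ) : ℤ) - 1) = (t - z) ^ k := by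
        rw [Nat.cast_succ, add_sub_cancel_right, zpow_natCast]
      have e2 : (t - z) ^ ((k : ℤ) - 1) = (t - z) ^ (-2 : ℤ) * (t - z) ^ (k + 1) := by
        rw [← zpow_natCast (t - z) (k + 1), ← zpow_add₀ ht']
        congr 1
        push_cast
        ring
      rw [e1, e2]
      push_cast
      ring
    rw [circleIntegral.integral_sub ((hint _ hf).const_mul ((k : ℂ) + 1))
      ((hint _ hf').const_mul a),
      circleIntegral.integral_const_mul, circleIntegral.integral_const_mul, h1, sub_eq_zero] at h2
    have hk : (k : ℂ) + 1 ≠ 0 := Nat.cast_add_one_ne_zero k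
    have hk' : (k.factorial : ℂ) ≠ 0 := Nat.cast_ne_zero.2 k.factorial_ne_zero
    apply mul_left_cancel₀ hk
    rw [h2, Nat.factorial_succ]
    push_cast
    field_simp
    ring

/-- `L` and `q` are bounded on the compact circle, so on the unit ball about `ν` a constant
dominates the derivative of the integrand. -/
theorem hasDerivAt_circleIntegral_exp_mul {c : ℂ} {R : ℝ} (hR : 0 ≤ R) {L q : ℂ → ℂ}
    (hL : ContinuousOn L (sphere c R)) (hq : ContinuousOn q (sphere c R)) (ν : ℂ) :
    HasDerivAt (fun ν : ℂ => ∮ t in C(c, R), exp (ν * L t) * q t)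
      (∮ t in C(c, R), L t * (exp (ν * L t) * q t)) ν := by
  obtain ⟨B, hB⟩ := (isCompact_sphere c R).exists_bound_of_continuousOn hL
  obtain ⟨Q, hQ⟩ := (isCompact_sphere c R).exists_bound_of_continuousOn hq
  have hmem : ∀ θ, circleMap c R θ ∈ sphere c R := circleMap_mem_sphere c hR
  have hLc : Continuous fun θ => L (circleMap c R θ) :=
    hL.comp_continuous (continuous_circleMap c R) hmem
  have hqc : Continuous fun θ => q (circleMap c R θ) :=
    hq.comp_continuous (continuous_circleMap c R) hmem
  have hdc : Continuous fun θ => deriv (circleMap c R) θ := by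
    simp only [deriv_circleMap]
    exact (continuous_circleMap 0 R).mul continuous_const
  have hB0 : 0 ≤ B := (norm_nonneg _).trans (hB _ (hmem 0))
  have hQ0 : 0 ≤ Q := (norm_nonneg _).trans (hQ _ (hmem 0))
  refine (intervalIntegral.hasDerivAt_integral_of_dominated_loc_of_deriv_le
    (F := fun ν θ => deriv (circleMap c R) θ • (exp (ν * L (circleMap c R θ)) *
      q (circleMap c R θ)))
    (F' := fun ν θ => deriv (circleMap c R) θ • (L (circleMap c R θ) *
      (exp (ν * L (circleMap c R θ)) * q (circleMap c R θ))))
    (bound := fun _ => |R| * (B * (Real.exp ((‖ν‖ + 1) * B) * Q)))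
    (ball_mem_nhds ν one_pos) ?_ ?_ ?_ ?_ ?_ ?_).2
  · exact Filter.Eventually.of_forall fun x => Continuous.aestronglyMeasurable (hdc.smul ((continuous_const.mul hLc).cexp.mul hqc))
  · exact Continuous.intervalIntegrable (hdc.smul ((continuous_const.mul hLc).cexp.mul hqc)) _ _
  · exact Continuous.aestronglyMeasurable (hdc.smul (hLc.mul ((continuous_const.mul hLc).cexp.mul hqc)))
  · refine Filter.Eventually.of_forall fun θ _ x hx => ?_
    rw [norm_smul, norm_mul, norm_mul, Complex.norm_exp]
    have hx' : ‖x‖ ≤ ‖ν‖ + 1 := by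
      rw [mem_ball, dist_eq_norm] at hx
      have := norm_le_norm_add_norm_sub' x ν
      linarith
    have h1 : ‖deriv (circleMap c R) θ‖ = |R| := by simp [deriv_circleMap]
    rw [h1]
    have h2 : (x * L (circleMap c R θ)).re ≤ (‖ν‖ + 1) * B :=
      (Complex.re_le_norm _).trans (by
        rw [norm_mul]
        exact mul_le_mul hx' (hB _ (hmem θ)) (norm_nonneg _) (by positivity))
    have h3 := hB _ (hmem θ)
    have h4 := hQ _ (hmem θ)
    gcongr
  · simp
  · refine Filter.Eventually.of_forall fun θ _ x _ => ?_
    have h := (((hasDerivAt_id x).mul_const (L (circleMap c R θ))).cexp.mul_const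
      (q (circleMap c R θ))).const_smul (deriv (circleMap c R) θ)
    refine h.congr_deriv ?_
    simp only [id, smul_eq_mul]
    ring

/-! ### Branches of the logarithm -/

/-- Both sides have the same exponential, and the imaginary part of the right side vanishes at `x =
y`, hence stays in `(-π, π)` nearby. -/
theorem eventually_log_div_eq_sub {y : ℂ} (hy : y ∈ slitPlane) {b : ℝ} (hb : 0 < b) :
    ∀ᶠ x in nhds y, log (x / y) = log (x / b) - log (y / b) := by
  have hbC : (b : ℂ) ≠ 0 := ofReal_ne_zero.2 hb.ne'
  have hyb : y / b ∈ slitPlane := by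
    rw [mem_slitPlane_iff_arg] at hy ⊢
    rw [div_eq_mul_inv, ← ofReal_inv, arg_mul_real (by positivity)]
    exact ⟨hy.1, by simpa using ⟨hy.2, hb.ne'⟩⟩
  have hc : ContinuousAt (fun x : ℂ => (log (x / b) - log (y / b)).im) y := by
    have : ContinuousAt (fun x : ℂ => log (x / b)) y :=
      ContinuousAt.clog (by fun_prop) hyb
    exact continuous_im.continuousAt.comp (this.sub continuousAt_const)
  have hm : ∀ᶠ x : ℂ in nhds y, (log (x / b) - log (y / b)).im ∈ Set.Ioo (-Real.pi) Real.pi :=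
    hc.eventually (Ioo_mem_nhds (by simp [Real.pi_pos]) (by simp [Real.pi_pos]))
  filter_upwards [hm, eventually_ne_nhds (slitPlane_ne_zero hy)] with x hx hx0
  rw [← log_exp hx.1 hx.2.le, exp_sub, exp_log (div_ne_zero hx0 hbC),
    exp_log (slitPlane_ne_zero hyb), div_div_div_cancel_right₀ hbC]

/-- If the quotient were `-a` with `a ≥ 0`, then `t = (w + a * z) / (1 + a)` would lie on the
segment from `w` to `z`, inside the convex ball. -/
theorem div_sub_mem_slitPlane {w z c t : ℂ} {R : ℝ} (hw : w ∈ ball c R) (hz : z ∈ ball c R)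
    (ht : t ∉ ball c R) : (t - w) / (t - z) ∈ slitPlane := by
  rw [mem_slitPlane_iff_not_le_zero]
  intro h
  have htz : t - z ≠ 0 := fun h0 => ht (by rwa [sub_eq_zero.1 h0])
  obtain ⟨hre, him⟩ := Complex.le_def.1 h
  set a : ℝ := -((t - w) / (t - z)).re with ha
  have ha0 : 0 ≤ a := by simpa [ha] using hre
  have e : (t - w) / (t - z) = ((-a : ℝ) : ℂ) := by
    apply Complex.ext
    · simp [ha]
    · simpa using him
  rw [div_eq_iff htz] at e
  have h1 : (1 : ℝ) + a ≠ 0 := by positivity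
  have h1' : (1 : ℂ) + a ≠ 0 := by exact_mod_cast h1
  refine ht ?_
  have hc := (convex_ball c R) hw hz (a := 1 / (1 + a)) (b := a / (1 + a)) (by positivity)
    (by positivity) (by field_simp)
  convert hc using 1
  simp only [real_smul]
  push_cast at e ⊢
  field_simp
  linear_combination e

theorem log_div_two {x : ℂ} (hx : x ≠ 0) : log (x / 2) = log x - log 2 := by
  have := log_ofReal_mul (r := 1 / 2) (by norm_num) hx
  have h2 : Complex.log 2 = (Real.log 2 : ℝ) := by
    rw [ofReal_log (by norm_num)]
    norm_num
  rw [h2, div_eq_inv_mul, sub_eq_neg_add, ← ofReal_neg, ← Real.log_inv]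
  simpa using this

theorem div_two_mem_slitPlane {x : ℂ} (hx : x ∈ slitPlane) : x / 2 ∈ slitPlane := by
  rw [mem_slitPlane_iff] at hx ⊢
  simpa using hx

theorem differentiableOn_sq_sub_one_pow_mul_log (n : ℕ) :
    DifferentiableOn ℂ (fun w : ℂ => (w ^ 2 - 1) ^ n * log ((w + 1) / 2))
      {w | w + 1 ∈ slitPlane} := fun w hw => by
  have : DifferentiableAt ℂ (fun w : ℂ => log ((w + 1) / 2)) w :=
    DifferentiableAt.clog (by fun_prop) (div_two_mem_slitPlane hw)
  exact (DifferentiableAt.mul (by fun_prop) this).differentiableWithinAt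

theorem isOpen_setOf_add_one_mem_slitPlane : IsOpen {w : ℂ | w + 1 ∈ slitPlane} :=
  isOpen_slitPlane.preimage (continuous_id.add continuous_const)

theorem IsSchlafliCircle.closedBall_subset {z c : ℂ} {R : ℝ} (hC : IsSchlafliCircle z c R) :
    closedBall c R ⊆ {w | w + 1 ∈ slitPlane} := by
  intro t ht
  by_contra h
  rw [Set.mem_ofPred_eq, mem_slitPlane_iff_not_le_zero, not_not, Complex.le_def] at h
  refine hC.2.2 t.re (by simpa [← le_neg_iff_add_nonpos_right] using h.1) ?_
  convert ht using 1
  apply Complex.ext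
  · simp
  · simpa using h.2.symm

theorem add_one_mem_slitPlane_of_sub_one {z : ℂ} (hz : z - 1 ∈ slitPlane) :
    z + 1 ∈ slitPlane := by
  rw [mem_slitPlane_iff] at hz ⊢
  simp only [sub_re, one_re, sub_im, one_im, sub_zero, add_re, add_im, add_zero] at hz ⊢
  exact hz.imp (fun h => by linarith) id

/-! ### The derivative of Schläfli's integral -/

/-- The contribution of the logarithm of `(t - 1) / (t - z)`, evaluated by the substitution
`(t - z) * (s - z) = z ^ 2 - 1` on a large circle. -/
theorem circleIntegral_mul_log_div {z c : ℂ} {R : ℝ} (hz : z - 1 ∈ slitPlane)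
    (h1 : 1 ∈ ball c R) (hzR : z ∈ ball c R) {m n : ℕ} (hmn : m ≤ n) :
    (∮ t in C(c, R), (log ((t - 1) / (t - z)) + log ((z + 1) / 2)) *
        ((t ^ 2 - 1) ^ n / (t - z) ^ (n + m + 1))) =
      2 * Real.pi * I / ((n - m).factorial : ℂ) * ((z ^ 2 - 1) ^ m)⁻¹ *
        iteratedDeriv (n - m) (fun w : ℂ => (w ^ 2 - 1) ^ n * log ((w + 1) / 2)) z := by
  have hR0 : 0 < R := dist_nonneg.trans_lt hzR
  have hz1 := add_one_mem_slitPlane_of_sub_one hz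
  have hzm0 : z - 1 ≠ 0 := slitPlane_ne_zero hz
  have hzp0 : z + 1 ≠ 0 := slitPlane_ne_zero hz1
  have ha : z ^ 2 - 1 ≠ 0 := by
    rw [show z ^ 2 - 1 = (z - 1) * (z + 1) by ring]
    exact mul_ne_zero hzm0 hzp0
  have hev : ∀ᶠ s in nhds z, s + 1 ∈ slitPlane ∧
      log ((s + 1) / (z + 1)) = log ((s + 1) / 2) - log ((z + 1) / 2) := by
    refine Filter.Eventually.and
      (isOpen_setOf_add_one_mem_slitPlane.eventually_mem (x := z) hz1) ?_
    have h := eventually_log_div_eq_sub hz1 (b := 2) two_pos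
    have hc : Filter.Tendsto (fun s : ℂ => s + 1) (nhds z) (nhds (z + 1)) :=
      (continuous_id.add continuous_const).tendsto z
    simpa using hc.eventually h
  obtain ⟨r, hr0, hr⟩ := Metric.eventually_nhds_iff_ball.1 hev
  have hfar : ∀ t, t ∉ ball c R → t - z ≠ 0 := fun t ht h => ht (by rwa [sub_eq_zero.1 h])
  -- On this circle `‖t - z‖ > ‖z ^ 2 - 1‖ / r`, which puts `s` in the ball where the logarithm
  -- identity holds.
  set R' : ℝ := R + ‖z ^ 2 - 1‖ / r with hR'
  have hRR' : R ≤ R' := by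
    have : 0 ≤ ‖z ^ 2 - 1‖ / r := by positivity
    linarith
  have hzR' : z ∈ ball c R' := ball_subset_ball hRR' hzR
  have hsph : ∀ t ∈ sphere c R', t ∉ ball c R := fun t ht h =>
    (mem_sphere.1 ht).not_lt ((mem_ball.1 h).trans_le hRR')
  have hs : ∀ t ∈ sphere c R', z + (z ^ 2 - 1) / (t - z) ∈ ball z r := by
    intro t ht
    have h0 := hfar t (hsph t ht)
    rw [mem_ball, dist_eq_norm, add_sub_cancel_left, norm_div, div_lt_iff₀ (norm_pos_iff.2 h0)]
    have h2 : R' ≤ dist t z + dist z c := by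
      rw [← mem_sphere.1 ht]
      exact dist_triangle t z c
    rw [dist_eq_norm t z] at h2
    have h3 := mem_ball.1 hzR
    have h4 : ‖z ^ 2 - 1‖ / r < ‖t - z‖ := by linarith
    rwa [div_lt_iff₀' hr0] at h4
  have hdiff : ∀ t, t ∉ ball c R → DifferentiableAt ℂ
      (fun t => (log ((t - 1) / (t - z)) + log ((z + 1) / 2)) *
        ((t ^ 2 - 1) ^ n / (t - z) ^ (n + m + 1))) t := by
    intro t ht
    have h0 := hfar t ht
    have hl : DifferentiableAt ℂ (fun t => log ((t - 1) / (t - z))) t :=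
      DifferentiableAt.clog (DifferentiableAt.div (by fun_prop) (by fun_prop) h0)
        (div_sub_mem_slitPlane h1 hzR ht)
    exact (hl.add_const _).mul
      (DifferentiableAt.div (by fun_prop) (by fun_prop) (pow_ne_zero _ h0))
  -- The integrand is analytic outside the original ball, so the contour may be enlarged.
  rw [← circleIntegral_eq_of_differentiable_on_annulus_off_countable hR0 hRR'
    Set.countable_empty (fun t ht => (hdiff t ht.2).continuousAt.continuousWithinAt)
    (fun t ht => hdiff t fun h => ht.1.2 (ball_subset_closedBall h))]
  have key := circleIntegral_comp_inv_mul_zpow_eq_iteratedDeriv hzR' hs (n - m)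
    ((differentiableOn_sq_sub_one_pow_mul_log n).mono fun s hs => (hr s hs).1)
  have hcongr : (∮ t in C(c, R'), (log ((t - 1) / (t - z)) + log ((z + 1) / 2)) *
        ((t ^ 2 - 1) ^ n / (t - z) ^ (n + m + 1))) =
      ∮ t in C(c, R'), ((z ^ 2 - 1) ^ n)⁻¹ *
        ((fun w : ℂ => (w ^ 2 - 1) ^ n * log ((w + 1) / 2)) (z + (z ^ 2 - 1) / (t - z)) *
          (t - z) ^ (((n - m : ℕ) : ℤ) - 1)) := by
    refine circleIntegral.integral_congr (hR0.le.trans hRR') fun t ht => ?_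
    have h0 := hfar t (hsph t ht)
    have hlog := (hr _ (hs t ht)).2
    have e1 : (z + (z ^ 2 - 1) / (t - z) + 1) / (z + 1) = (t - 1) / (t - z) := by
      field_simp
      ring
    have e2 : (z + (z ^ 2 - 1) / (t - z)) ^ 2 - 1 =
        (t ^ 2 - 1) * (z ^ 2 - 1) / (t - z) ^ 2 := by
      field_simp
      ring
    have e3 : (t - z) ^ (((n - m : ℕ) : ℤ) - 1) = ((t - z) ^ 2) ^ n / (t - z) ^ (n + m + 1) := by
      rw [eq_div_iff (pow_ne_zero _ h0), ← pow_mul, ← zpow_natCast, ← zpow_natCast,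
        ← zpow_add₀ h0]
      congr 1
      push_cast [hmn]
      ring
    rw [e1] at hlog
    simp only [hlog, e2, e3, sub_add_cancel]
    rw [div_pow, mul_pow]
    field_simp
  rw [hcongr, circleIntegral.integral_const_mul, key]
  -- The inversion supplies `(z ^ 2 - 1) ^ (n - m)`; against `(z ^ 2 - 1) ^ n` this leaves the
  -- inverse `m`-th power.
  rw [show (z ^ 2 - 1) ^ n = (z ^ 2 - 1) ^ m * (z ^ 2 - 1) ^ (n - m) by
    rw [← pow_add, Nat.add_sub_cancel' hmn]]
  field_simp

theorem schlafliIntegrand_natCast {z t : ℂ} (h0 : t + 1 ≠ 0) (hz : t - z ≠ 0) (m n : ℕ) :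
    schlafliIntegrand n m z t = (t ^ 2 - 1) ^ n / (t - z) ^ (n + m + 1) := by
  rw [schlafliIntegrand, cpow_natCast, cpow_natCast, div_pow,
    show t ^ 2 - 1 = (t + 1) * (t - 1) by ring, mul_pow]
  field_simp
  ring

theorem hasDerivAt_circleIntegral_schlafliIntegrand {z c : ℂ} {R : ℝ} (hz : z - 1 ∈ slitPlane)
    (hC : IsSchlafliCircle z c R) {m n : ℕ} (hmn : m ≤ n) :
    HasDerivAt (fun ν : ℂ => ∮ t in C(c, R), schlafliIntegrand ν m z t)
      (2 * Real.pi * I / ((n + m).factorial : ℂ) *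
          iteratedDeriv (n + m) (fun w : ℂ => (w ^ 2 - 1) ^ n * log ((w + 1) / 2)) z +
        2 * Real.pi * I / ((n - m).factorial : ℂ) * ((z ^ 2 - 1) ^ m)⁻¹ *
          iteratedDeriv (n - m) (fun w : ℂ => (w ^ 2 - 1) ^ n * log ((w + 1) / 2)) z +
        (log 2 - log ((z + 1) / 2)) * ∮ t in C(c, R), schlafliIntegrand n m z t) (n : ℂ) := by
  have hR0 : 0 < R := dist_nonneg.trans_lt hC.1
  have hnb : ∀ t ∈ sphere c R, t ∉ ball c R := fun t ht h => (mem_sphere.1 ht).not_lt h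
  have hne : ∀ t ∈ sphere c R, t - z ≠ 0 := fun t ht h =>
    hnb t ht (by rw [sub_eq_zero.1 h]; exact hC.2.1)
  have hsl : ∀ t ∈ sphere c R, t + 1 ∈ slitPlane := fun t ht =>
    hC.closedBall_subset (sphere_subset_closedBall ht)
  have hw : ∀ t ∈ sphere c R, (t - 1) / (t - z) ∈ slitPlane := fun t ht =>
    div_sub_mem_slitPlane hC.1 hC.2.1 (hnb t ht)
  have hc1 : ContinuousOn (fun t : ℂ => log (t + 1)) (sphere c R) :=
    ContinuousOn.clog (by fun_prop) hsl
  have hc1' : ContinuousOn (fun t : ℂ => log ((t + 1) / 2)) (sphere c R) :=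
    ContinuousOn.clog (by fun_prop) fun t ht => div_two_mem_slitPlane (hsl t ht)
  have hc2 : ContinuousOn (fun t : ℂ => log ((t - 1) / (t - z))) (sphere c R) :=
    ContinuousOn.clog (ContinuousOn.div (by fun_prop) (by fun_prop) hne) hw
  have hc3 : ∀ j : ℕ, ContinuousOn (fun t : ℂ => ((t - z) ^ j)⁻¹) (sphere c R) := fun j =>
    ContinuousOn.inv₀ (by fun_prop) fun t ht => pow_ne_zero _ (hne t ht)
  have hq : ContinuousOn (fun t : ℂ => (t ^ 2 - 1) ^ n / (t - z) ^ (n + m + 1)) (sphere c R) :=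
    ContinuousOn.mul (by fun_prop) (hc3 _)
  have hexp : ∀ ν : ℂ, ∀ t ∈ sphere c R, schlafliIntegrand ν m z t =
      exp (ν * (log (t + 1) + log ((t - 1) / (t - z)))) * ((t - z) ^ (m + 1))⁻¹ := by
    intro ν t ht
    rw [schlafliIntegrand, cpow_def_of_ne_zero (slitPlane_ne_zero (hsl t ht)),
      cpow_def_of_ne_zero (slitPlane_ne_zero (hw t ht)), ← exp_add, div_eq_mul_inv]
    ring_nf
  have hfun : (fun ν : ℂ => ∮ t in C(c, R), schlafliIntegrand ν m z t) = fun ν : ℂ =>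
      ∮ t in C(c, R), exp (ν * (log (t + 1) + log ((t - 1) / (t - z)))) *
        ((t - z) ^ (m + 1))⁻¹ :=
    funext fun ν => circleIntegral.integral_congr hR0.le (hexp ν)
  have hnat : (∮ t in C(c, R), schlafliIntegrand n m z t) =
      ∮ t in C(c, R), (t ^ 2 - 1) ^ n / (t - z) ^ (n + m + 1) :=
    circleIntegral.integral_congr hR0.le fun t ht =>
      schlafliIntegrand_natCast (slitPlane_ne_zero (hsl t ht)) (hne t ht) m n
  rw [hfun, hnat]
  refine (hasDerivAt_circleIntegral_exp_mul hR0.le (hc1.add hc2) (hc3 (m + 1)) n).congr_deriv ?_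
  -- Adding and subtracting `log ((z + 1) / 2)` completes the logarithm of the quotient to `log ((s
  -- + 1) / 2)`; `log 2` compensates for halving `t + 1`.
  have hcongr : (∮ t in C(c, R), (log (t + 1) + log ((t - 1) / (t - z))) *
        (exp (n * (log (t + 1) + log ((t - 1) / (t - z)))) * ((t - z) ^ (m + 1))⁻¹)) =
      ∮ t in C(c, R), ((((t ^ 2 - 1) ^ n * log ((t + 1) / 2)) * ((t - z) ^ (n + m + 1))⁻¹ +
        (log ((t - 1) / (t - z)) + log ((z + 1) / 2)) *
          ((t ^ 2 - 1) ^ n / (t - z) ^ (n + m + 1))) +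
        (log 2 - log ((z + 1) / 2)) * ((t ^ 2 - 1) ^ n / (t - z) ^ (n + m + 1))) := by
    refine circleIntegral.integral_congr hR0.le fun t ht => ?_
    have hsl0 := slitPlane_ne_zero (hsl t ht)
    rw [← hexp n t ht, schlafliIntegrand_natCast hsl0 (hne t ht), log_div_two hsl0]
    ring
  have i1 : ContinuousOn (fun t : ℂ => ((t ^ 2 - 1) ^ n * log ((t + 1) / 2)) *
      ((t - z) ^ (n + m + 1))⁻¹) (sphere c R) :=
    (ContinuousOn.mul (by fun_prop) hc1').mul (hc3 _)
  have i2 : ContinuousOn (fun t : ℂ => (log ((t - 1) / (t - z)) + log ((z + 1) / 2)) *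
      ((t ^ 2 - 1) ^ n / (t - z) ^ (n + m + 1))) (sphere c R) :=
    (hc2.add continuousOn_const).mul hq
  simp only [Pi.add_apply]
  rw [hcongr, circleIntegral.integral_add ((i1.fun_add i2).circleIntegrable hR0.le)
      ((hq.circleIntegrable hR0.le).const_mul _),
    circleIntegral.integral_add (i1.circleIntegrable hR0.le) (i2.circleIntegrable hR0.le),
    circleIntegral.integral_const_mul, circleIntegral_mul_log_div hz hC.1 hC.2.1 hmn,
    circleIntegral_mul_inv_pow_eq_iteratedDeriv isOpen_setOf_add_one_mem_slitPlane
      hC.closedBall_subset hC.2.1 (n + m) (differentiableOn_sq_sub_one_pow_mul_log n)]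

/-! ### The prefactor and the final formula -/

theorem hasDerivAt_Gamma_natCast_add_one (k : ℕ) :
    HasDerivAt Gamma (digamma (k + 1) * Gamma (k + 1)) ((k : ℂ) + 1) := by
  have hd : DifferentiableAt ℂ Gamma ((k : ℂ) + 1) := by
    refine differentiableAt_Gamma _ fun j h => ?_
    have : ((k + 1 + j : ℕ) : ℂ) = 0 := by
      push_cast
      rw [h]
      ring
    exact absurd (Nat.cast_eq_zero.1 this) (by omega)
  have h0 : Gamma ((k : ℂ) + 1) ≠ 0 := by
    rw [Gamma_nat_eq_factorial]
    exact Nat.cast_ne_zero.2 k.factorial_ne_zero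
  refine hd.hasDerivAt.congr_deriv ?_
  rw [digamma_def, logDeriv_apply, div_mul_cancel₀ _ h0]

/-- Logarithmic differentiation; the `-log 2` from `2 ^ (ν + 1)` later cancels the `log 2` of the
integral. -/
theorem hasDerivAt_assocLegendreP_prefactor (m n : ℕ) :
    HasDerivAt (fun ν : ℂ => Gamma (ν + m + 1) / Gamma (ν + 1) *
        (1 / (2 ^ (ν + 1) * Real.pi * I)))
      ((digamma (n + m + 1) - digamma (n + 1) - log 2) *
        (((n + m).factorial : ℂ) / (n.factorial : ℂ) * (1 / (2 ^ (n + 1) * Real.pi * I))))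
      (n : ℂ) := by
  have hn : (n.factorial : ℂ) ≠ 0 := Nat.cast_ne_zero.2 n.factorial_ne_zero
  have g1 : HasDerivAt (fun ν : ℂ => Gamma (ν + m + 1))
      (digamma (n + m + 1) * ((n + m).factorial : ℂ)) (n : ℂ) := by
    have h := hasDerivAt_Gamma_natCast_add_one (n + m)
    rw [Gamma_nat_eq_factorial] at h
    push_cast at h
    rw [add_assoc] at h
    have := h.comp_add_const (n : ℂ) (m + 1)
    simpa only [add_assoc] using this
  have g2 : HasDerivAt (fun ν : ℂ => Gamma (ν + 1))
      (digamma (n + 1) * (n.factorial : ℂ)) (n : ℂ) := by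
    have h := hasDerivAt_Gamma_natCast_add_one n
    rw [Gamma_nat_eq_factorial] at h
    exact h.comp_add_const (n : ℂ) 1
  have v1 : Gamma ((n : ℂ) + m + 1) = ((n + m).factorial : ℂ) := by
    rw [← Gamma_nat_eq_factorial]
    push_cast
    rfl
  have v2 := Gamma_nat_eq_factorial n
  have v3 : (2 : ℂ) ^ ((n : ℂ) + 1) = 2 ^ (n + 1) := by
    rw [← cpow_natCast]
    push_cast
    rfl
  have hpi : (Real.pi : ℂ) ≠ 0 := ofReal_ne_zero.2 Real.pi_ne_zero
  have g3 : HasDerivAt (fun ν : ℂ => (2 : ℂ) ^ (ν + 1) * Real.pi * I)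
      (2 ^ (n + 1) * log 2 * Real.pi * I) (n : ℂ) := by
    have h := ((hasDerivAt_id (n : ℂ)).add_const 1).const_cpow (c := (2 : ℂ)) (Or.inl two_ne_zero)
    simp only [id, mul_one] at h
    rw [v3] at h
    exact (h.mul_const _).mul_const _
  have hne : (2 : ℂ) ^ ((n : ℂ) + 1) * Real.pi * I ≠ 0 := by
    rw [v3]
    simp [hpi]
  have h := (g1.div g2 (by rw [v2]; exact hn)).mul (g3.inv hne)
  simp only [one_div]
  refine h.congr_deriv ?_
  simp only [Pi.div_apply, Pi.inv_apply, v1, v2, v3]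
  field_simp
  ring

theorem sqSubOnePow_neg_half {z : ℂ} (hz : z - 1 ∈ slitPlane) (m : ℕ) :
    sqSubOnePow z (-(m / 2)) = sqSubOnePow z (m / 2) * ((z ^ 2 - 1) ^ m)⁻¹ := by
  have h : ∀ x : ℂ, x ≠ 0 → x ^ (-((m : ℂ) / 2)) = x ^ ((m : ℂ) / 2) * (x ^ m)⁻¹ := by
    intro x hx
    rw [← cpow_natCast, ← cpow_neg, ← cpow_add _ _ hx]
    congr 1
    ring
  rw [sqSubOnePow, sqSubOnePow, h _ (slitPlane_ne_zero hz),
    h _ (slitPlane_ne_zero (add_one_mem_slitPlane_of_sub_one hz)),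
    show z ^ 2 - 1 = (z - 1) * (z + 1) by ring, mul_pow, mul_inv]
  ring

theorem mainTheorem2 (n : ℕ) (z : ℂ) (hz : z - 1 ∈ Complex.slitPlane)
    (c : ℂ) (R : ℝ) (hC : IsSchlafliCircle z c R) :
    (∀ m : ℕ, m ≤ n →
      HasDerivAt (fun ν : ℂ => assocLegendreP c R ν m z)
        (-assocLegendreP c R n m z * Complex.log ((z + 1) / 2)
          + (Complex.digamma (n + m + 1) - Complex.digamma (n + 1)) * assocLegendreP c R n m z
          + 1 / (2 ^ n * (n.factorial : ℂ)) * sqSubOnePow z (m / 2) *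
              iteratedDeriv (n + m)
                (fun w : ℂ => (w ^ 2 - 1) ^ n * Complex.log ((w + 1) / 2)) z
          + ((n + m).factorial : ℂ) / ((n - m).factorial : ℂ) *
              (1 / (2 ^ n * (n.factorial : ℂ))) * sqSubOnePow z (-(m / 2)) *
              iteratedDeriv (n - m)
                (fun w : ℂ => (w ^ 2 - 1) ^ n * Complex.log ((w + 1) / 2)) z)
        (n : ℂ)) ∧
    HasDerivAt (fun ν : ℂ => assocLegendreP c R ν 0 z)
      (-assocLegendreP c R n 0 z * Complex.log ((z + 1) / 2)
        + 1 / ((2 : ℂ) ^ ((n : ℤ) - 1) * (n.factorial : ℂ)) *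
            iteratedDeriv n
              (fun w : ℂ => (w ^ 2 - 1) ^ n * Complex.log ((w + 1) / 2)) z)
      (n : ℂ) := by

  have hpi : (Real.pi : ℂ) ≠ 0 := ofReal_ne_zero.2 Real.pi_ne_zero
  have hn : (n.factorial : ℂ) ≠ 0 := Nat.cast_ne_zero.2 n.factorial_ne_zero
  have main : ∀ m : ℕ, m ≤ n →
      HasDerivAt (fun ν : ℂ => assocLegendreP c R ν m z)
        (-assocLegendreP c R n m z * Complex.log ((z + 1) / 2)
          + (Complex.digamma (n + m + 1) - Complex.digamma (n + 1)) * assocLegendreP c R n m z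
          + 1 / (2 ^ n * (n.factorial : ℂ)) * sqSubOnePow z (m / 2) *
              iteratedDeriv (n + m)
                (fun w : ℂ => (w ^ 2 - 1) ^ n * Complex.log ((w + 1) / 2)) z
          + ((n + m).factorial : ℂ) / ((n - m).factorial : ℂ) *
              (1 / (2 ^ n * (n.factorial : ℂ))) * sqSubOnePow z (-(m / 2)) *
              iteratedDeriv (n - m)
                (fun w : ℂ => (w ^ 2 - 1) ^ n * Complex.log ((w + 1) / 2)) z)
        (n : ℂ) := by
    intro m hmn
    have hnm : ((n + m).factorial : ℂ) ≠ 0 := Nat.cast_ne_zero.2 (n + m).factorial_ne_zero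
    have hnm' : ((n - m).factorial : ℂ) ≠ 0 := Nat.cast_ne_zero.2 (n - m).factorial_ne_zero
    have v1 : Gamma ((n : ℂ) + m + 1) = ((n + m).factorial : ℂ) := by
      rw [← Gamma_nat_eq_factorial]
      push_cast
      rfl
    have v3 : (2 : ℂ) ^ ((n : ℂ) + 1) = 2 ^ (n + 1) := by
      rw [← cpow_natCast]
      push_cast
      rfl
    have hP : assocLegendreP c R n m z =
        ((n + m).factorial : ℂ) / (n.factorial : ℂ) * (1 / (2 ^ (n + 1) * Real.pi * I)) *
          sqSubOnePow z (m / 2) * ∮ t in C(c, R), schlafliIntegrand n m z t := by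
      rw [assocLegendreP, v1, Gamma_nat_eq_factorial, v3]
    have h := ((hasDerivAt_assocLegendreP_prefactor m n).mul_const (sqSubOnePow z (m / 2))).mul
      (hasDerivAt_circleIntegral_schlafliIntegrand hz hC hmn)
    refine h.congr_deriv ?_
    rw [hP, sqSubOnePow_neg_half hz, v1, Gamma_nat_eq_factorial, v3]
    -- What remains is a rational identity in the integral, the two derivatives, the logarithms, the
    -- digamma values and the powers.
    generalize (∮ t in C(c, R), schlafliIntegrand n m z t) = J
    generalize (fun w : ℂ => (w ^ 2 - 1) ^ n * Complex.log ((w + 1) / 2)) = F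
    generalize iteratedDeriv (n + m) F z = A
    generalize iteratedDeriv (n - m) F z = B
    generalize sqSubOnePow z (m / 2) = S
    generalize ((z ^ 2 - 1) ^ m)⁻¹ = T
    field_simp
    ring
  refine ⟨main, (main 0 n.zero_le).congr_deriv ?_⟩
  have hs : sqSubOnePow z 0 = 1 := by simp [sqSubOnePow]
  -- For `m = 0` the two derivative terms coincide, which doubles `1 / 2 ^ n`; the integer exponent
  -- makes `n = 0` give `1 / 2`.
  have h2 : (2 : ℂ) ^ ((n : ℤ) - 1) = 2 ^ n / 2 := by
    rw [zpow_sub₀ two_ne_zero, zpow_natCast, zpow_one]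
  simp only [Nat.cast_zero, zero_div, neg_zero, add_zero, Nat.sub_zero, hs, sub_self, zero_mul,
    div_self hn, h2]
  field_simp
  ring
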